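/- **Spaces.** Identify a white noise functional with its sequence of symmetric chaos kernels $\Phi=\sum_n I_n(\Phi^{(n)})$, $\Phi^{(n)}\in \widehat{L}^2(\mathbb R^n)$ (real-valued), and put $\|\Phi\|_\lambda^2=\sum_n n!\,e^{2\lambda n}|\Phi^{(n)}|^2_{L^2(\mathbb R^n)}$. Then $\mathcal G^*$ is the space of all $\Phi$ with $\|\Phi\|_{-\lambda}<\infty$ for some $\lambda>0$, $\mathcal G$ the space of all $\varphi$ with $\|\varphi\|_\lambda<\infty$ for all $\lambda>0$, and $\langle\langle\Phi,\varphi\rangle\rangle=\sum_n n!\langle\Phi^{(n)},\varphi^{(n)}\rangle$. For $\xi\in\mathcal S(\mathbb R)$ let $\mathcal S(\Phi)(\xi)=\langle\langle \Phi, e^{\langle\cdot,\xi\rangle-|\xi|^2/2}\rangle\rangle$, where $e^{\langle\cdot,\xi\rangle-|\xi|^2/2}=\sum_n I_n(\xi^{\otimes n}/n!)$. The Wick product $\Phi\diamond\Psi$ is the element of $\mathcal G^*$ with $\mathcal S(\Phi\diamond\Psi)=\mathcal S(\Phi)\,\mathcal S(\Psi)$. Pettis integrals in $\mathcal G^*$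 are taken weakly against all $\varphi\in\mathcal G$. **Operators.** Let $t\ge 0$ and let $g$ be a real kernel. For a real function $f$ put $$\mathcal K_g(f)(t,s)=f(s)g(t,s)+\int_{(s,t]}(f(u)-f(s))\,g(du,s),$$ a Lebesgue–Stieltjes integral, where $u\mapsto g(u,s)$ has bounded variation on $[a,t]$ for every $a\in(s,t)$ (it may be singular at $u=s$); for a $\mathcal G^*$-valued process $\Phi$ the same formula defines $\mathcal K_g(\Phi)(t,s)\in\mathcal G^*$ with a Pettis–Stieltjes integral. The Skorohod integral over $[0,t]$ of a process $f$ whose $n$-th kernels $f^{(n)}(\cdot,s)\mathbf 1_{[0,t]}(s)$ are jointly in $L^2(\mathbb R^{n+1})$ is $\int_0^t f(s)\,\delta B(s)=\sum_n I_{n+1}(\widehat f^{(n)})$, the hat being symmetrization in all $n+1$ variables, provided that this is in $\mathcal G^*$. *Values at a point.* Fix a bounded measurable function $\rho$ with bounded support and $\int\rho=1$, and put $\rho_{s,r}(v)=r^{-1}\rho((v-s)/r)$. The stochastic derivative $D_s\Phi=\sum_n (n+1) I_n(\Phi^{(n+1)}(\cdot,s))$ is understood as the weak limit, as $r\downarrow0$,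 of $D_{\rho_{s,r}}\Phi=\sum_n (n+1)I_n\big((\rho_{s,r},\Phi^{(n+1)})_{L^2(\mathbb R)}\big)$. If $F:\mathcal S(\mathbb R)\to\mathbb R$ is Fréchet differentiable at $\xi$ with respect to the $L^2(\mathbb R)$-norm, with derivative $\eta\mapsto\int d(v)\eta(v)\,dv$, $d\in L^2(\mathbb R)$, then $\frac{\delta}{\delta\xi(s)}F$ is the value $\lim_{r\downarrow0}\int d(v)\rho_{s,r}(v)\,dv$ of $d$ at $s$. **Integrals.** $\Phi$ is *$dX_1$-integrable on $[0,t]$* if $\mathcal K_g(\Phi)(t,s)$ exists in $\mathcal G^*$ for a.e. $s\in[0,t]$; $\int_0^t\|\mathcal K_g(\Phi)(t,s)\|_{-\lambda}^2ds<\infty$ for some $\lambda>0$ and $\mathcal K_g(\Phi)(t,\cdot)$ has a Skorohod integral over $[0,t]$; and $D_s\{\mathcal K_g(\Phi)(t,s)\}$ exists in $\mathcal G^*$ for a.e. $s$ and is Pettis integrable on $[0,t]$, with integral in $\mathcal G^*$. Then $$\int_0^t\Phi\,dX_1=\int_0^t\mathcal K_g(\Phi)(t,s)\,\delta B(s)+\int_0^tD_s\{\mathcal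 K_g(\Phi)(t,s)\}\,ds .$$ Given a second $\mathcal G^*$-valued process $\Sigma$, *$dX_{\diamond\Sigma}$-integrability* and $$\int_0^t\Phi\,dX_{\diamond\Sigma}=\int_0^t\mathcal K_g(\Phi)(t,s)\diamond\Sigma(s)\,\delta B(s)+\int_0^tD_s\{\mathcal K_g(\Phi)(t,s)\}\diamond\Sigma(s)\,ds$$ are defined in the same way, the Skorohod and square integrability conditions being imposed on $\mathcal K_g(\Phi)(t,s)\diamond\Sigma(s)$ and Pettis integrability on $D_s\{\mathcal K_g(\Phi)(t,s)\}\diamond\Sigma(s)$. **Theorem.** (1) If $\Phi$ is $dX_1$-integrable on $[0,t]$, then for every $\xi\in\mathcal S(\mathbb R)$ $$\mathcal S\Big(\int_0^t\Phi\,dX_1\Big)(\xi)=\int_0^t\mathcal K_g(\mathcal S(\Phi)(\xi))(t,s)\,\xi(s)\,ds+\int_0^t\frac{\delta}{\delta\xi(s)}\Big\{\mathcal K_g(\mathcal S(\Phi)(\xi))(t,s)\Big\}\,ds .$$ (2) If $\Phi$ is $dX_{\diamond\Sigma}$-integrable on $[0,t]$, then for every $\xi\in\mathcal S(\mathbb R)$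 $$\mathcal S\Big(\int_0^t\Phi\,dX_{\diamond\Sigma}\Big)(\xi)=\int_0^t\mathcal K_g(\mathcal S(\Phi)(\xi))(t,s)\,\mathcal S(\Sigma(s))(\xi)\,\xi(s)\,ds+\int_0^t\frac{\delta}{\delta\xi(s)}\Big\{\mathcal K_g(\mathcal S(\Phi)(\xi))(t,s)\Big\}\,\mathcal S(\Sigma(s))(\xi)\,ds .$$ Here $\mathcal K_g(\mathcal S(\Phi)(\xi))$ is $\mathcal K_g$ applied to the real function $u\mapsto\mathcal S(\Phi(u))(\xi)$. In both parts, for a.e. $s\in[0,t]$ the Stieltjes integrals in $\mathcal K_g(\mathcal S(\Phi)(\eta))(t,s)$ converge absolutely for all $\eta\in\mathcal S(\mathbb R)$ and the functional derivative at $\xi$ exists, and all the $ds$-integrals on the right converge absolutely. -/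

import Mathlib

open MeasureTheory Filter Topology Set
open scoped SchwartzMap ENNReal

/-!
White noise analysis in the chaos (Fock space) picture. By the Wiener–Itô theorem a square
integrable functional of white noise is the same thing as its sequence of symmetric kernels
`(φ⁽ⁿ⁾)`, `φ⁽ⁿ⁾ ∈ L²(ℝⁿ)`, and the Potthoff–Timpel generalized random variables are the formal
series `∑ Iₙ(Φ⁽ⁿ⁾)` with a finite exponentially weighted norm.
-/

/-- The real Hilbert space `L²(ℝⁿ)`. -/
abbrev L2 (n : ℕ) : Type := Lp ℝ 2 (volume : Measure (Fin n → ℝ))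

/-- The real Hilbert space `L²(ℝ)`. -/
abbrev L2R : Type := Lp ℝ 2 (volume : Measure ℝ)

/-- `f` is invariant under all permutations of its arguments. -/
def IsSymmKernel {n : ℕ} (f : L2 n) : Prop :=
  ∀ σ : Equiv.Perm (Fin n), (fun x : Fin n → ℝ => f (x ∘ σ)) =ᵐ[volume] f

/-- `‖φ‖_lam² = ∑ₙ n! e^{2 lam n} |φ⁽ⁿ⁾|²`, with value in `[0, ∞]`. -/
noncomputable def chaosNormSq (lam : ℝ) (f : ∀ n, L2 n) : ℝ≥0∞ :=
  ∑' n : ℕ, ENNReal.ofReal ((n.factorial : ℝ) * Real.exp (2 * lam * n) * ‖f n‖ ^ 2)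

theorem chaosNormSq_zero (lam : ℝ) : chaosNormSq lam 0 = 0 := by
  simp [chaosNormSq]

theorem chaosNormSq_mono {lam lam' : ℝ} (h : lam ≤ lam') (f : ∀ n, L2 n) :
    chaosNormSq lam f ≤ chaosNormSq lam' f := by
  refine ENNReal.tsum_le_tsum fun n => ENNReal.ofReal_le_ofReal ?_
  gcongr

theorem chaosNormSq_add_le (lam : ℝ) (f g : ∀ n, L2 n) :
    chaosNormSq lam (f + g) ≤ 2 * chaosNormSq lam f + 2 * chaosNormSq lam g := by
  unfold chaosNormSq
  rw [← ENNReal.tsum_mul_left, ← ENNReal.tsum_mul_left, ← ENNReal.tsum_add]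
  refine ENNReal.tsum_le_tsum fun n => ?_
  have h2 : ∀ y : ℝ, (2 : ℝ≥0∞) * ENNReal.ofReal y = ENNReal.ofReal (2 * y) := fun y => by
    rw [ENNReal.ofReal_mul (by norm_num)]
    simp
  rw [h2, h2, ← ENNReal.ofReal_add (by positivity) (by positivity)]
  refine ENNReal.ofReal_le_ofReal ?_
  have h : ‖(f + g) n‖ ^ 2 ≤ 2 * ‖f n‖ ^ 2 + 2 * ‖g n‖ ^ 2 := by
    have h1 : ‖(f + g) n‖ ≤ ‖f n‖ + ‖g n‖ := norm_add_le _ _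
    nlinarith [norm_nonneg ((f + g) n), norm_nonneg (f n), norm_nonneg (g n),
      sq_nonneg (‖f n‖ - ‖g n‖)]
  have hc : 0 ≤ (n.factorial : ℝ) * Real.exp (2 * lam * n) := by positivity
  nlinarith [mul_le_mul_of_nonneg_left h hc]

theorem chaosNormSq_smul (lam c : ℝ) (f : ∀ n, L2 n) :
    chaosNormSq lam (c • f) = ENNReal.ofReal (c ^ 2) * chaosNormSq lam f := by
  unfold chaosNormSq
  rw [← ENNReal.tsum_mul_left]
  refine tsum_congr fun n => ?_
  rw [← ENNReal.ofReal_mul (by positivity), Pi.smul_apply, norm_smul, mul_pow, Real.norm_eq_abs,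
    sq_abs]
  congr 1
  ring

theorem permMeasurePreserving {n : ℕ} (σ : Equiv.Perm (Fin n)) :
    MeasurePreserving (fun x : Fin n → ℝ => x ∘ σ) volume volume := by
  have h := volume_measurePreserving_piCongrLeft (fun _ : Fin n => ℝ) σ.symm
  convert h using 1
  ext x i
  have := Equiv.piCongrLeft_apply_apply (fun _ : Fin n => ℝ) σ.symm x (σ i)
  simpa [MeasurableEquiv.coe_piCongrLeft] using this.symm

/-- The space `𝒢*` of generalized random variables: sequences of symmetric square integrable
kernels with `‖Φ‖_{-lam} < ∞` for some `lam > 0`. -/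
noncomputable def GStar : Submodule ℝ (∀ n, L2 n) where
  carrier := {f | (∀ n, IsSymmKernel (f n)) ∧ ∃ lam : ℝ, 0 < lam ∧ chaosNormSq (-lam) f < ∞}
  zero_mem' := by
    refine ⟨fun n σ => ?_, 1, one_pos, by simp [chaosNormSq_zero]⟩
    have h0 : ((0 : ∀ n, L2 n) n : (Fin n → ℝ) → ℝ) =ᵐ[volume] 0 := Lp.coeFn_zero _ _ _
    exact ((permMeasurePreserving σ).quasiMeasurePreserving.ae_eq_comp h0).trans h0.symm
  add_mem' := by
    rintro f g ⟨hf, a, ha, hfa⟩ ⟨hg, b, hb, hgb⟩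
    refine ⟨fun n σ => ?_, max a b, lt_max_of_lt_left ha, ?_⟩
    · have h0 : ((f + g) n : (Fin n → ℝ) → ℝ) =ᵐ[volume] (f n : (Fin n → ℝ) → ℝ) + g n :=
        Lp.coeFn_add _ _
      exact ((permMeasurePreserving σ).quasiMeasurePreserving.ae_eq_comp h0).trans
        (((hf n σ).add (hg n σ)).trans h0.symm)
    · refine (chaosNormSq_add_le _ f g).trans_lt (ENNReal.add_lt_top.2 ⟨?_, ?_⟩)
      · exact ENNReal.mul_lt_top (by simp)
          ((chaosNormSq_mono (neg_le_neg (le_max_left a b)) f).trans_lt hfa)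
      · exact ENNReal.mul_lt_top (by simp)
          ((chaosNormSq_mono (neg_le_neg (le_max_right a b)) g).trans_lt hgb)
  smul_mem' := by
    rintro c f ⟨hf, a, ha, hfa⟩
    refine ⟨fun n σ => ?_, a, ha, ?_⟩
    · have h0 : ((c • f) n : (Fin n → ℝ) → ℝ) =ᵐ[volume] c • (f n : (Fin n → ℝ) → ℝ) :=
        Lp.coeFn_smul _ _
      exact ((permMeasurePreserving σ).quasiMeasurePreserving.ae_eq_comp h0).trans
        (((hf n σ).const_smul c).trans h0.symm)
    · rw [chaosNormSq_smul]
      exact ENNReal.mul_lt_top ENNReal.ofReal_lt_top hfa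

/-- Membership in the space `𝒢` of test random variables: symmetric kernels and
`‖φ‖_lam < ∞` for every `lam > 0`. -/
def IsTest (φ : ∀ n, L2 n) : Prop :=
  (∀ n, IsSymmKernel (φ n)) ∧ ∀ lam : ℝ, 0 < lam → chaosNormSq lam φ < ∞

/-- The bilinear pairing `⟪⟪Φ, φ⟫⟫ = ∑ₙ n! ⟨Φ⁽ⁿ⁾, φ⁽ⁿ⁾⟩`. -/
noncomputable def pairing (Φ φ : ∀ n, L2 n) : ℝ :=
  ∑' n : ℕ, (n.factorial : ℝ) * inner ℝ (Φ n) (φ n)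

theorem memLp_tensorPow (ξ : 𝓢(ℝ, ℝ)) (n : ℕ) :
    MemLp (fun x : Fin n → ℝ => ∏ i, ξ (x i)) 2 volume := by
  have hc : Continuous (fun x : Fin n → ℝ => ∏ i, ξ (x i)) :=
    continuous_finsetProd _ fun i _ => ξ.continuous.comp (continuous_apply i)
  rw [memLp_two_iff_integrable_sq hc.aestronglyMeasurable]
  have h : Integrable (fun y : ℝ => ξ y ^ 2) volume := (ξ.memLp 2 volume).integrable_sq
  have := Integrable.fintype_prod (ι := Fin n) (E := ℝ) (f := fun _ y => ξ y ^ 2)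
    (μ := fun _ => volume) (fun _ => h)
  simp only [Finset.prod_pow] at this
  exact this

/-- The normalized exponential `exp(⟨·, ξ⟩ - |ξ|²/2) = ∑ₙ Iₙ(ξ^{⊗n} / n!)`. -/
noncomputable def expVector (ξ : 𝓢(ℝ, ℝ)) : ∀ n, L2 n :=
  fun n => ((n.factorial : ℝ)⁻¹) • (memLp_tensorPow ξ n).toLp

/-- The `S`-transform `S(Φ)(ξ) = ⟪⟪Φ, exp(⟨·, ξ⟩ - |ξ|²/2)⟫⟫`. -/
noncomputable def STransform (Φ : GStar) (ξ : 𝓢(ℝ, ℝ)) : ℝ :=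
  pairing Φ (expVector ξ)

/-- `Θ` is the Wick product of `Φ` and `Ψ`: `Θ = S⁻¹(SΦ · SΨ)`. -/
def IsWickProduct (Φ Ψ Θ : GStar) : Prop :=
  ∀ ξ : 𝓢(ℝ, ℝ), STransform Θ ξ = STransform Φ ξ * STransform Ψ ξ

/-! ### Pettis integral over `[0, t]` and the Skorohod integral -/

/-- `Y = ∫₀ᵗ f(s) ds` in the sense of Pettis. -/
def IsPettisIntegral (t : ℝ) (f : ℝ → GStar) (Y : GStar) : Prop :=
  ∀ φ : ∀ n, L2 n, IsTest φ →
    IntegrableOn (fun s => pairing (f s) φ) (Ioc 0 t) ∧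
      pairing Y φ = ∫ s in Ioc 0 t, pairing (f s) φ

/-- `Y = ∫₀ᵗ f(s) δB(s)`. Here `κ n`, as a function of `(s, x) ∈ ℝ × ℝⁿ`, is the `n`-th kernel of
the process `s ↦ f(s) 1_{[0,t]}(s)`; the `(n+1)`-st kernel of `Y` is its symmetrization. -/
def IsSkorohodIntegral (t : ℝ) (f : ℝ → GStar) (Y : GStar) : Prop :=
  ∃ κ : ∀ n, L2 (n + 1),
    (∀ n, ∀ᵐ s : ℝ, (fun x : Fin n → ℝ => κ n (Fin.cons s x : Fin (n + 1) → ℝ)) =ᵐ[volume]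
      (Ioc (0 : ℝ) t).indicator (fun s => (f s : ∀ n, L2 n) n) s) ∧
    (Y : ∀ n, L2 n) 0 = 0 ∧
    ∀ n, ((Y : ∀ n, L2 n) (n + 1) : (Fin (n + 1) → ℝ) → ℝ) =ᵐ[volume]
      fun y => (((n + 1).factorial : ℝ))⁻¹ * ∑ σ : Equiv.Perm (Fin (n + 1)), κ n (y ∘ σ)

/-- `∫₀ᵗ ‖f(s)‖²_{-lam} ds < ∞` for some `lam > 0`. -/
def SquareIntegrableProcess (t : ℝ) (f : ℝ → GStar) : Prop :=
  ∃ lam : ℝ, 0 < lam ∧ ∫⁻ s in Ioc 0 t, chaosNormSq (-lam) (f s) < ∞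

/-! ### The stochastic derivative and the functional derivative

`D_sΦ` and `δF/δξ(s)` are the values at the point `s` of objects that are only defined for almost
every value of the variable. Since they are needed for `Φ` and `F` that depend on `s`
themselves, the value at `s` is taken as a limit along an approximate identity. -/

/-- A bounded measurable profile with bounded support and integral one. -/
structure Profile where
  toFun : ℝ → ℝ
  measurable_toFun : Measurable toFun
  bound : ∃ C R : ℝ, ∀ x, |toFun x| ≤ C ∧ (R < |x| → toFun x = 0)
  integral_eq_one : ∫ x, toFun x = 1

theorem Profile.memLp (ρ : Profile) (s r : ℝ) :
    MemLp (fun v : ℝ => r⁻¹ * ρ.toFun ((v - s) / r)) 2 volume := by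
  obtain ⟨C, R, hCR⟩ := ρ.bound
  rcases eq_or_ne r 0 with rfl | hr
  · simp
  have hm : Measurable (fun v : ℝ => r⁻¹ * ρ.toFun ((v - s) / r)) :=
    (ρ.measurable_toFun.comp ((measurable_id.sub_const s).div_const r)).const_mul _
  have hI : MemLp ((Metric.closedBall s (|r| * R)).indicator fun _ => |r⁻¹| * C) 2
      (volume : Measure ℝ) :=
    memLp_indicator_const 2 Metric.isClosed_closedBall.measurableSet _
      (Or.inr measure_closedBall_lt_top.ne)
  refine hI.mono hm.aestronglyMeasurable (ae_of_all _ fun v => ?_)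
  by_cases hv : v ∈ Metric.closedBall s (|r| * R)
  · rw [indicator_of_mem hv, norm_mul, Real.norm_eq_abs, Real.norm_eq_abs, Real.norm_eq_abs,
      abs_mul, abs_abs]
    exact mul_le_mul_of_nonneg_left ((hCR _).1.trans (le_abs_self C)) (abs_nonneg _)
  · have : R < |(v - s) / r| := by
      rw [abs_div, lt_div_iff₀ (abs_pos.2 hr)]
      rw [Metric.mem_closedBall, Real.dist_eq, not_le] at hv
      linarith
    simp [(hCR _).2 this]

/-- The approximation `v ↦ r⁻¹ ρ((v - s) / r)` of the Dirac delta at `s`. -/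
noncomputable def Profile.delta (ρ : Profile) (s r : ℝ) : L2R :=
  (ρ.memLp s r).toLp

theorem memLp_contract {n : ℕ} (h : L2R) (f : L2 (n + 1)) :
    MemLp (fun x : Fin n → ℝ => ∫ v : ℝ, h v * f (Fin.cons v x : Fin (n + 1) → ℝ)) 2 volume := by
  have hF : MemLp (fun p : ℝ × (Fin n → ℝ) => f (Fin.cons p.1 p.2 : Fin (n + 1) → ℝ)) 2
      ((volume : Measure ℝ).prod (volume : Measure (Fin n → ℝ))) := by
    have hp := (volume_preserving_piFinSuccAbove (fun _ : Fin (n + 1) => ℝ) 0).symm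
    have := (Lp.memLp f).comp_measurePreserving hp
    rw [← Measure.volume_eq_prod]
    convert this using 1
    ext p
    simp only [Function.comp_apply, MeasurableEquiv.piFinSuccAbove_symm_apply,
      Fin.insertNthEquiv_zero]
    rfl
  have hh : MemLp h 2 (volume : Measure ℝ) := Lp.memLp h
  have hswap : AEStronglyMeasurable
      (fun p : (Fin n → ℝ) × ℝ => h p.2 * f (Fin.cons p.2 p.1 : Fin (n + 1) → ℝ))
      ((volume : Measure (Fin n → ℝ)).prod (volume : Measure ℝ)) := by
    have h1 := hh.1.comp_snd (μ := (volume : Measure (Fin n → ℝ)))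
    have h2 := hF.1.prod_swap
    exact h1.mul h2
  have hmeas : AEStronglyMeasurable
      (fun x : Fin n → ℝ => ∫ v : ℝ, h v * f (Fin.cons v x : Fin (n + 1) → ℝ)) volume :=
    hswap.integral_prod_right'
  have hsq : Integrable
      (fun p : (Fin n → ℝ) × ℝ => f (Fin.cons p.2 p.1 : Fin (n + 1) → ℝ) ^ 2)
      ((volume : Measure (Fin n → ℝ)).prod (volume : Measure ℝ)) := by
    have := hF.integrable_sq.swap
    exact this
  have hI : Integrable
      (fun x : Fin n → ℝ => (∫ v, h v ^ 2) * ∫ v, f (Fin.cons v x : Fin (n + 1) → ℝ) ^ 2)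
      volume := hsq.integral_prod_left.const_mul _
  rw [memLp_two_iff_integrable_sq hmeas]
  refine hI.mono' (hmeas.pow 2) ?_
  have hsec : ∀ᵐ x : Fin n → ℝ, AEStronglyMeasurable
      (fun v : ℝ => f (Fin.cons v x : Fin (n + 1) → ℝ)) volume := hF.1.prod_swap.prodMk_left
  filter_upwards [hsq.prod_right_ae, hsec] with x hx hxm
  have hfx : MemLp (fun v : ℝ => f (Fin.cons v x : Fin (n + 1) → ℝ)) 2 volume :=
    (memLp_two_iff_integrable_sq hxm).2 hx
  have key : ∀ (a b : L2R), (inner ℝ a b) ^ 2 ≤ (inner ℝ a a) * (inner ℝ b b) := fun a b => by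
    have := real_inner_mul_inner_self_le a b
    nlinarith
  have hk := key h hfx.toLp
  have e1 : inner ℝ h hfx.toLp = ∫ v : ℝ, h v * f (Fin.cons v x : Fin (n + 1) → ℝ) := by
    rw [L2.inner_def]
    refine integral_congr_ae ?_
    filter_upwards [hfx.coeFn_toLp] with v hv
    rw [hv, RCLike.inner_apply, conj_trivial, mul_comm]
  have e2 : inner ℝ h h = ∫ v : ℝ, h v ^ 2 := by
    rw [L2.inner_def]
    refine integral_congr_ae (ae_of_all _ fun v => ?_)
    simp only [RCLike.inner_apply, conj_trivial, pow_two]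
  have e3 : inner ℝ hfx.toLp hfx.toLp = ∫ v : ℝ, f (Fin.cons v x : Fin (n + 1) → ℝ) ^ 2 := by
    rw [L2.inner_def]
    refine integral_congr_ae ?_
    filter_upwards [hfx.coeFn_toLp] with v hv
    rw [hv, RCLike.inner_apply, conj_trivial, pow_two]
  rw [e1, e2, e3] at hk
  rw [Real.norm_eq_abs, abs_of_nonneg (sq_nonneg _)]
  exact hk

/-- The directional derivative `D_hΦ = ∑ₙ (n + 1) Iₙ((h, Φ⁽ⁿ⁺¹⁾)_{L²(ℝ)})`, `h ∈ L²(ℝ)`. -/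
noncomputable def dirDeriv (h : L2R) (Φ : ∀ n, L2 n) : ∀ n, L2 n :=
  fun n => ((n : ℝ) + 1) • (memLp_contract h (Φ (n + 1))).toLp

/-- `Ψ = D_sΦ = ∑ₙ (n + 1) Iₙ(Φ⁽ⁿ⁺¹⁾(s, ·))`, the value at `s` being the weak limit of `D_hΦ` as
`h` runs through the approximations of the Dirac delta at `s`. For fixed `Φ` this is the usual
derivative for almost every `s`. -/
def IsStochDeriv (ρ : Profile) (Φ : GStar) (s : ℝ) (Ψ : GStar) : Prop :=
  ∀ φ : ∀ n, L2 n, IsTest φ →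
    Tendsto (fun r => pairing (dirDeriv (ρ.delta s r) Φ) φ) (𝓝[>] 0) (𝓝 (pairing Ψ φ))

/-- The linear functional `η ↦ ⟨d, η⟩` is the Fréchet derivative of `F` at `ξ` with respect to the
`L²(ℝ)`-norm, that is, `d` is the density of the functional derivative of `F` at `ξ`. -/
def HasFunctionalGradient (F : 𝓢(ℝ, ℝ) → ℝ) (ξ : 𝓢(ℝ, ℝ)) (d : L2R) : Prop :=
  (fun η : 𝓢(ℝ, ℝ) => F (ξ + η) - F ξ - inner ℝ d (η.toLp 2))
    =o[comap (fun η : 𝓢(ℝ, ℝ) => ‖η.toLp 2‖) (𝓝 0)] (fun η : 𝓢(ℝ, ℝ) => ‖η.toLp 2‖)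

/-- `δF/δξ(s) = c`: the functional derivative of `F` at `ξ` exists, and `c` is the value of its
density at the point `s`. -/
def HasFunctionalDerivAt (ρ : Profile) (F : 𝓢(ℝ, ℝ) → ℝ) (ξ : 𝓢(ℝ, ℝ)) (s c : ℝ) : Prop :=
  ∃ d : L2R, HasFunctionalGradient F ξ d ∧
    Tendsto (fun r => inner ℝ d (ρ.delta s r)) (𝓝[>] 0) (𝓝 c)

/-! ### Lebesgue–Stieltjes integrals over `(s, t]`

The integrator may have unbounded variation at `s`, so its Lebesgue–Stieltjes measure on `(s, t]`
is a difference of two positive measures that are finite on each `(a, t]`, `s < a < t`. -/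

open Classical in
/-- The signed Lebesgue–Stieltjes measure of `G` on `(a, t]`. It does not see the values of `G`
outside `[a, t]`. -/
noncomputable def stieltjesSigned (G : ℝ → ℝ) (a t : ℝ) : SignedMeasure ℝ :=
  if h : BoundedVariationOn (fun u => G (max a (min u t))) univ then
    h.vectorMeasure.restrict (Ioc a t)
  else 0

/-- The positive part of the Lebesgue–Stieltjes measure of `G` on `(s, t]`. -/
noncomputable def stieltjesPos (G : ℝ → ℝ) (s t : ℝ) : Measure ℝ :=
  ⨆ n : ℕ, (stieltjesSigned G (s + (t - s) / (n + 2)) t).toJordanDecomposition.posPart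

/-- The negative part of the Lebesgue–Stieltjes measure of `G` on `(s, t]`. -/
noncomputable def stieltjesNeg (G : ℝ → ℝ) (s t : ℝ) : Measure ℝ :=
  ⨆ n : ℕ, (stieltjesSigned G (s + (t - s) / (n + 2)) t).toJordanDecomposition.negPart

/-- `∫_{(s,t]} |f| d|G| < ∞`. -/
def StieltjesIntegrable (f G : ℝ → ℝ) (s t : ℝ) : Prop :=
  Integrable f (stieltjesPos G s t) ∧ Integrable f (stieltjesNeg G s t)

/-- `∫_{(s,t]} f dG`. -/
noncomputable def stieltjesIntegral (f G : ℝ → ℝ) (s t : ℝ) : ℝ :=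
  ∫ u, f u ∂(stieltjesPos G s t) - ∫ u, f u ∂(stieltjesNeg G s t)

/-! ### The operator `𝒦_g` -/

/-- `𝒦_g(f)(t, s) = f(s) g(t, s) + ∫_s^t (f(u) - f(s)) g(du, s)` for a real function `f`. -/
noncomputable def volterraK (g : ℝ → ℝ → ℝ) (f : ℝ → ℝ) (t s : ℝ) : ℝ :=
  f s * g t s + stieltjesIntegral (fun u => f u - f s) (fun u => g u s) s t

/-- `X = 𝒦_g(Φ)(t, s) = Φ(s) g(t, s) + ∫_s^t (Φ(u) - Φ(s)) g(du, s)` for a process `Φ` in `𝒢*`,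
where `J` is the integral in the sense of Pettis–Stieltjes. -/
def IsVolterraK (g : ℝ → ℝ → ℝ) (Φ : ℝ → GStar) (t s : ℝ) (X : GStar) : Prop :=
  LocallyBoundedVariationOn (fun u => g u s) (Ioc s t) ∧
  ∃ J : GStar,
    (∀ φ : ∀ n, L2 n, IsTest φ →
      StieltjesIntegrable (fun u => pairing (Φ u - Φ s : GStar) φ) (fun u => g u s) s t ∧
      pairing J φ = stieltjesIntegral (fun u => pairing (Φ u - Φ s : GStar) φ) (fun u => g u s) s t) ∧
    X = g t s • Φ s + J

/-! ### Integrals with respect to Volterra processes -/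

/-- `Φ` is `dX₁`-integrable on `[0, t]` and
`Y = ∫₀ᵗ Φ dX₁ = ∫₀ᵗ 𝒦_g(Φ)(t,s) δB(s) + ∫₀ᵗ D_s{𝒦_g(Φ)(t,s)} ds`. -/
def HasVolterraIntegral (ρ : Profile) (g : ℝ → ℝ → ℝ) (Φ : ℝ → GStar) (t : ℝ) (Y : GStar) :
    Prop :=
  ∃ (K D : ℝ → GStar) (A B : GStar),
    (∀ᵐ s ∂(volume.restrict (Ioc 0 t)), IsVolterraK g Φ t s (K s)) ∧
    SquareIntegrableProcess t K ∧
    IsSkorohodIntegral t K A ∧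
    (∀ᵐ s ∂(volume.restrict (Ioc 0 t)), IsStochDeriv ρ (K s) s (D s)) ∧
    IsPettisIntegral t D B ∧
    Y = A + B

/-- `Φ` is integrable on `[0, t]` with respect to the Wick modulated process `X_{⋄Σ}`, and
`Y = ∫₀ᵗ Φ dX_{⋄Σ} = ∫₀ᵗ 𝒦_g(Φ)(t,s) ⋄ Σ(s) δB(s) + ∫₀ᵗ D_s{𝒦_g(Φ)(t,s)} ⋄ Σ(s) ds`.
Here `Sig` is the volatility `Σ`. -/
def HasWickVolterraIntegral (ρ : Profile) (g : ℝ → ℝ → ℝ) (Φ Sig : ℝ → GStar) (t : ℝ)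
    (Y : GStar) : Prop :=
  ∃ (K D KW DW : ℝ → GStar) (A B : GStar),
    (∀ᵐ s ∂(volume.restrict (Ioc 0 t)), IsVolterraK g Φ t s (K s)) ∧
    (∀ᵐ s ∂(volume.restrict (Ioc 0 t)), IsWickProduct (K s) (Sig s) (KW s)) ∧
    SquareIntegrableProcess t KW ∧
    IsSkorohodIntegral t KW A ∧
    (∀ᵐ s ∂(volume.restrict (Ioc 0 t)), IsStochDeriv ρ (K s) s (D s)) ∧
    (∀ᵐ s ∂(volume.restrict (Ioc 0 t)), IsWickProduct (D s) (Sig s) (DW s)) ∧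
    IsPettisIntegral t DW B ∧
    Y = A + B

/-! The `S`-transform is the pairing with the single functional `expVector ξ`, whose kernels
`ξ^{⊗n}/n!` decay fast enough to make it a test functional (`isTest_expVector`). Whatever is defined
weakly therefore passes under `S` by testing against it: Pettis and Pettis–Stieltjes integrals at
once, and Wick products by definition. Two points need work.

Skorohod integral. In each chaos the symmetrization is invisible to the symmetric kernel
`ξ^{⊗(n+1)}`, and Fubini in the first variable produces `∫ ⟨f⁽ⁿ⁾(s), ξ^{⊗n}⟩ ξ(s) ds`. Square
integrability of the process in a weighted norm allows the sum over `n` and the `ds`-integral to be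
exchanged (`IsSkorohodIntegral.STransform_eq`).

Functional derivative. `S(Φ)` is a power series in `ξ`, converging on every `L²`-ball. Multilinear
expansion of `(ξ + η)^{⊗n}` shows that it is Fréchet differentiable in the `L²`-norm, with
derivative `h ↦ ⟪⟪D_hΦ, expVector ξ⟫⟫` and a quadratic remainder
(`exists_abs_STransform_add_sub_le`). With `h` an approximate delta at `s`, the limit defining
`δ/δξ(s)` is the one defining `D_s` tested against `expVector ξ`. For fixed `s`, `S(𝒦_g(Φ)(t,s))`
and `𝒦_g(S(Φ))(t,s)` agree as functionals of `ξ`, so this applies to `𝒦_g`. -/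

section RealL2

variable {α : Type*} [MeasurableSpace α] {μ : Measure α}

/-! ### Real `L²` inner products and norms as integrals. -/

theorem real_inner_eq_integral_mul (f g : Lp ℝ 2 μ) : inner ℝ f g = ∫ x, f x * g x ∂μ := by
  rw [L2.inner_def]
  refine integral_congr_ae (ae_of_all _ fun x => ?_)
  simp only [RCLike.inner_apply, conj_trivial, mul_comm]

theorem real_inner_toLp (f : Lp ℝ 2 μ) {g : α → ℝ} (hg : MemLp g 2 μ) :
    inner ℝ f hg.toLp = ∫ x, f x * g x ∂μ := by
  rw [real_inner_eq_integral_mul]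
  refine integral_congr_ae ?_
  filter_upwards [hg.coeFn_toLp] with x hx
  rw [hx]

theorem norm_sq_toLp_two {g : α → ℝ} (hg : MemLp g 2 μ) : ‖hg.toLp‖ ^ 2 = ∫ x, g x ^ 2 ∂μ := by
  rw [← real_inner_self_eq_norm_sq, real_inner_toLp]
  refine integral_congr_ae ?_
  filter_upwards [hg.coeFn_toLp] with x hx
  rw [hx, sq]

end RealL2

/-! ### Tensor products of Schwartz functions -/

theorem memLp_tensorProd {n : ℕ} (f : Fin n → 𝓢(ℝ, ℝ)) :
    MemLp (fun x : Fin n → ℝ => ∏ i, f i (x i)) 2 volume := by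
  have hc : Continuous (fun x : Fin n → ℝ => ∏ i, f i (x i)) :=
    continuous_finsetProd _ fun i _ => (f i).continuous.comp (continuous_apply i)
  rw [memLp_two_iff_integrable_sq hc.aestronglyMeasurable]
  have := Integrable.fintype_prod (ι := Fin n) (E := ℝ) (f := fun i y => f i y ^ 2)
    (μ := fun _ => volume) (fun i => ((f i).memLp 2 volume).integrable_sq)
  simp only [Finset.prod_pow] at this
  exact this

/-- The kernel `f₁ ⊗ ⋯ ⊗ fₙ`. -/
noncomputable def tensorKernel {n : ℕ} (f : Fin n → 𝓢(ℝ, ℝ)) : L2 n :=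
  (memLp_tensorProd f).toLp

theorem norm_tensorKernel {n : ℕ} (f : Fin n → 𝓢(ℝ, ℝ)) :
    ‖tensorKernel f‖ = ∏ i, ‖(f i).toLp 2‖ := by
  refine (pow_left_inj₀ (norm_nonneg _) (Finset.prod_nonneg fun i _ => norm_nonneg _)
    two_ne_zero).1 ?_
  rw [tensorKernel, norm_sq_toLp_two, ← Finset.prod_pow]
  simp only [← Finset.prod_pow]
  rw [integral_fintype_prod_volume_eq_prod (fun i (y : ℝ) => f i y ^ 2)]
  refine Finset.prod_congr rfl fun i _ => ?_
  rw [SchwartzMap.toLp, norm_sq_toLp_two]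

theorem norm_tensorKernel_const (ξ : 𝓢(ℝ, ℝ)) (n : ℕ) :
    ‖tensorKernel (fun _ : Fin n => ξ)‖ = ‖ξ.toLp 2‖ ^ n := by
  simp [norm_tensorKernel]

theorem expVector_apply (ξ : 𝓢(ℝ, ℝ)) (n : ℕ) :
    expVector ξ n = ((n.factorial : ℝ)⁻¹) • tensorKernel (fun _ : Fin n => ξ) := rfl

theorem inner_tensorKernel {n : ℕ} (K : L2 n) (f : Fin n → 𝓢(ℝ, ℝ)) :
    inner ℝ K (tensorKernel f) = ∫ x, K x * ∏ i, f i (x i) :=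
  real_inner_toLp _ _

theorem abs_inner_tensorKernel_le {n : ℕ} (K : L2 n) (f : Fin n → 𝓢(ℝ, ℝ)) :
    |inner ℝ K (tensorKernel f)| ≤ ‖K‖ * ∏ i, ‖(f i).toLp 2‖ := by
  rw [← norm_tensorKernel]
  exact abs_real_inner_le_norm _ _

theorem integrable_mul_tensorProd {n : ℕ} (K : L2 n) (f : Fin n → 𝓢(ℝ, ℝ)) :
    Integrable (fun x => K x * ∏ i, f i (x i)) :=
  MemLp.integrable_mul (Lp.memLp K) (memLp_tensorProd f)

theorem integral_comp_of_measurePreserving {α β : Type*} [MeasurableSpace α] [MeasurableSpace β]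
    {μ : Measure α} {ν : Measure β} {φ : α → β} (hφ : MeasurePreserving φ μ ν) {F : β → ℝ}
    (hF : AEStronglyMeasurable F ν) : ∫ x, F (φ x) ∂μ = ∫ y, F y ∂ν := by
  obtain ⟨hm, rfl⟩ := hφ
  exact (integral_map hm.aemeasurable hF).symm

theorem integral_comp_perm {n : ℕ} (σ : Equiv.Perm (Fin n)) {F : (Fin n → ℝ) → ℝ}
    (hF : AEStronglyMeasurable F volume) : ∫ x, F (x ∘ σ) = ∫ x, F x :=
  integral_comp_of_measurePreserving (permMeasurePreserving σ) hF

/-- A change of variables by `σ⁻¹` moves the permutation from the factors to `K`, which does not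
notice it. -/
theorem inner_tensorKernel_comp_perm {n : ℕ} {K : L2 n} (hK : IsSymmKernel K)
    (f : Fin n → 𝓢(ℝ, ℝ)) (σ : Equiv.Perm (Fin n)) :
    inner ℝ K (tensorKernel (f ∘ σ)) = inner ℝ K (tensorKernel f) := by
  rw [inner_tensorKernel, inner_tensorKernel,
    ← integral_comp_perm σ⁻¹ (integrable_mul_tensorProd K f).aestronglyMeasurable]
  refine integral_congr_ae ?_
  filter_upwards [hK σ⁻¹] with x hx
  rw [hx]
  congr 1
  simpa using Equiv.prod_comp σ (fun i => f i ((x ∘ ⇑σ⁻¹) i))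

theorem isSymmKernel_tensorKernel_const (ξ : 𝓢(ℝ, ℝ)) (n : ℕ) :
    IsSymmKernel (tensorKernel (fun _ : Fin n => ξ)) := by
  intro σ
  have h0 := (memLp_tensorProd (fun _ : Fin n => ξ)).coeFn_toLp
  refine ((permMeasurePreserving σ).quasiMeasurePreserving.ae_eq_comp h0).trans
    (EventuallyEq.trans ?_ h0.symm)
  exact ae_of_all _ fun x => Equiv.prod_comp σ (fun i => ξ (x i))

theorem IsSymmKernel.const_smul {n : ℕ} {f : L2 n} (hf : IsSymmKernel f) (c : ℝ) :
    IsSymmKernel (c • f) := by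
  intro σ
  have h0 := Lp.coeFn_smul c f
  exact ((permMeasurePreserving σ).quasiMeasurePreserving.ae_eq_comp h0).trans
    (((hf σ).const_smul c).trans h0.symm)

/-- The squared factor `1/n!` beats the weight `n!`, so every weighted norm is an exponential
series. This is what makes all weak definitions usable under the `S`-transform. -/
theorem isTest_expVector (ξ : 𝓢(ℝ, ℝ)) : IsTest (expVector ξ) := by
  refine ⟨fun n => (isSymmKernel_tensorKernel_const ξ n).const_smul _, fun lam _ => ?_⟩
  have hs := Real.summable_pow_div_factorial (Real.exp (2 * lam) * ‖ξ.toLp 2‖ ^ 2)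
  refine lt_of_eq_of_lt ?_ (hs.tsum_ofReal_lt_top)
  refine tsum_congr fun n => ?_
  have hn : (n.factorial : ℝ) ≠ 0 := by positivity
  rw [expVector_apply, norm_smul, norm_tensorKernel_const, Real.norm_of_nonneg (by positivity),
    mul_comm (2 * lam) (n : ℝ), Real.exp_nat_mul]
  congr 1
  field_simp
  ring

/-! ### Summability of the pairing -/

theorem summable_of_chaosNormSq_lt_top {lam : ℝ} {f : ∀ n, L2 n} (h : chaosNormSq lam f < ∞) :
    Summable fun n : ℕ => (n.factorial : ℝ) * Real.exp (2 * lam * n) * ‖f n‖ ^ 2 := by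
  have := ENNReal.summable_toReal h.ne
  refine this.congr fun n => ENNReal.toReal_ofReal (by positivity)

theorem summable_pairing (Φ : GStar) {φ : ∀ n, L2 n} (hφ : IsTest φ) :
    Summable fun n : ℕ => (n.factorial : ℝ) * inner ℝ ((Φ : ∀ n, L2 n) n) (φ n) := by
  obtain ⟨-, lam, hlam, hΦ⟩ := Φ.2
  refine Summable.of_norm_bounded ((summable_of_chaosNormSq_lt_top hΦ).add
    (summable_of_chaosNormSq_lt_top (hφ.2 lam hlam))) fun n => ?_
  set a := ‖(Φ : ∀ n, L2 n) n‖
  set b := ‖φ n‖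
  have h1 : |inner ℝ ((Φ : ∀ n, L2 n) n) (φ n)| ≤ a * b := abs_real_inner_le_norm _ _
  set e := Real.exp (lam * n)
  have he : 0 < e := Real.exp_pos _
  have e1 : Real.exp (2 * lam * n) = e ^ 2 := by
    rw [← Real.exp_nat_mul]; congr 1; push_cast; ring
  have e2 : Real.exp (2 * -lam * n) = (e⁻¹) ^ 2 := by
    rw [← Real.exp_neg, ← Real.exp_nat_mul]; congr 1; push_cast; ring
  have h2 : a * b ≤ (e⁻¹ * a) ^ 2 + (e * b) ^ 2 := by
    have h3 : (e⁻¹ * a) * (e * b) = a * b := by field_simp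
    nlinarith [sq_nonneg (e⁻¹ * a - e * b), sq_nonneg (e⁻¹ * a + e * b)]
  rw [norm_mul, Real.norm_of_nonneg (by positivity), Real.norm_eq_abs, e1, e2]
  calc (n.factorial : ℝ) * |inner ℝ ((Φ : ∀ n, L2 n) n) (φ n)|
      ≤ n.factorial * ((e⁻¹ * a) ^ 2 + (e * b) ^ 2) := by gcongr; exact h1.trans h2
    _ = _ := by ring

theorem pairing_add (Φ Ψ : GStar) {φ : ∀ n, L2 n} (hφ : IsTest φ) :
    pairing (Φ + Ψ : GStar) φ = pairing Φ φ + pairing Ψ φ := by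
  rw [pairing, pairing, pairing, ← (summable_pairing Φ hφ).tsum_add (summable_pairing Ψ hφ)]
  refine tsum_congr fun n => ?_
  rw [Submodule.coe_add, Pi.add_apply, inner_add_left, mul_add]

theorem pairing_smul (c : ℝ) (Φ : GStar) (φ : ∀ n, L2 n) :
    pairing (c • Φ : GStar) φ = c * pairing Φ φ := by
  rw [pairing, pairing, ← tsum_mul_left]
  refine tsum_congr fun n => ?_
  rw [Submodule.coe_smul, Pi.smul_apply, real_inner_smul_left]
  ring

theorem pairing_sub (Φ Ψ : GStar) {φ : ∀ n, L2 n} (hφ : IsTest φ) :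
    pairing (Φ - Ψ : GStar) φ = pairing Φ φ - pairing Ψ φ := by
  have h := pairing_add (Φ - Ψ) Ψ hφ
  rw [sub_add_cancel] at h
  rw [h, add_sub_cancel_right]

theorem factorial_mul_inner_expVector {n : ℕ} (K : L2 n) (ξ : 𝓢(ℝ, ℝ)) :
    (n.factorial : ℝ) * inner ℝ K (expVector ξ n) =
      inner ℝ K (tensorKernel (fun _ : Fin n => ξ)) := by
  have hn : (n.factorial : ℝ) ≠ 0 := by positivity
  rw [expVector_apply, real_inner_smul_right, ← mul_assoc, mul_inv_cancel₀ hn, one_mul]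

theorem pairing_expVector (Φ : ∀ n, L2 n) (ξ : 𝓢(ℝ, ℝ)) :
    pairing Φ (expVector ξ) = ∑' n : ℕ, inner ℝ (Φ n) (tensorKernel (fun _ : Fin n => ξ)) :=
  tsum_congr fun n => factorial_mul_inner_expVector (Φ n) ξ

theorem hasSum_STransform (Φ : GStar) (ξ : 𝓢(ℝ, ℝ)) :
    HasSum (fun n : ℕ => inner ℝ ((Φ : ∀ n, L2 n) n) (tensorKernel (fun _ : Fin n => ξ)))
      (STransform Φ ξ) := by
  have h := summable_pairing Φ (isTest_expVector ξ)
  simp only [factorial_mul_inner_expVector] at h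
  rw [STransform, pairing_expVector]
  exact h.hasSum

/-- Young's inequality with the weight `√n! · e^{-lam n}` split off: the first term is the `n`-th
term of a negative-index chaos norm, the second that of an exponential series. The spare factor `b`
is `1` for summability at a single `Φ`, and `|ξ(s)|` for domination along a process. -/
theorem norm_mul_pow_le (n : ℕ) (lam a x : ℝ) (b : ℝ) (hx : 0 ≤ x) (ha : 0 ≤ a) (hb : 0 ≤ b) :
    x * a ^ n * b ≤ (n.factorial : ℝ) * Real.exp (2 * -lam * n) * x ^ 2 +
      (Real.exp (2 * lam) * a ^ 2) ^ n / n.factorial * b ^ 2 := by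
  set e := Real.exp (lam * n)
  have he : 0 < e := Real.exp_pos _
  have e1 : Real.exp (2 * lam) ^ n = e ^ 2 := by
    rw [← Real.exp_nat_mul, ← Real.exp_nat_mul]; congr 1; push_cast; ring
  have e2 : Real.exp (2 * -lam * n) = (e⁻¹) ^ 2 := by
    rw [← Real.exp_neg, ← Real.exp_nat_mul]; congr 1; push_cast; ring
  set N := (n.factorial : ℝ)
  have hN : 0 < N := by positivity
  set r := √N
  have hr : 0 < r := Real.sqrt_pos.2 hN
  have hr2 : N = r ^ 2 := (Real.sq_sqrt hN.le).symm
  rw [mul_pow, e1, e2, hr2, ← pow_mul, mul_comm 2 n, pow_mul]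
  have h3 : (r * e⁻¹ * x) * (e * a ^ n / r * b) = x * a ^ n * b := by field_simp
  have h0 : 0 ≤ (r * e⁻¹ * x) * (e * a ^ n / r * b) := by positivity
  have h4 : r ^ 2 * e⁻¹ ^ 2 * x ^ 2 + e ^ 2 * (a ^ n) ^ 2 / r ^ 2 * b ^ 2 =
      (r * e⁻¹ * x) ^ 2 + (e * a ^ n / r * b) ^ 2 := by
    field_simp
  rw [h4, ← h3]
  nlinarith [sq_nonneg (r * e⁻¹ * x - e * a ^ n / r * b)]

theorem summable_norm_mul_pow (Φ : GStar) {a : ℝ} (ha : 0 ≤ a) :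
    Summable fun n : ℕ => ‖(Φ : ∀ n, L2 n) n‖ * a ^ n := by
  obtain ⟨-, lam, -, hΦ⟩ := Φ.2
  refine Summable.of_nonneg_of_le (fun n => by positivity) (fun n => ?_)
    ((summable_of_chaosNormSq_lt_top hΦ).add
      (Real.summable_pow_div_factorial (Real.exp (2 * lam) * a ^ 2)))
  simpa using norm_mul_pow_le n lam a _ 1 (norm_nonneg ((Φ : ∀ n, L2 n) n)) ha zero_le_one

/-! ### Splitting off the first variable of a kernel -/

theorem measurePreserving_finCons (n : ℕ) :
    MeasurePreserving (fun p : ℝ × (Fin n → ℝ) => (Fin.cons p.1 p.2 : Fin (n + 1) → ℝ))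
      ((volume : Measure ℝ).prod volume) volume := by
  have hp := (volume_preserving_piFinSuccAbove (fun _ : Fin (n + 1) => ℝ) 0).symm
  rw [← Measure.volume_eq_prod]
  have h : (fun p : ℝ × (Fin n → ℝ) => (Fin.cons p.1 p.2 : Fin (n + 1) → ℝ)) =
      (MeasurableEquiv.piFinSuccAbove (fun _ : Fin (n + 1) => ℝ) 0).symm := by
    funext p
    simp only [MeasurableEquiv.piFinSuccAbove_symm_apply, Fin.insertNthEquiv_zero]
    rfl
  rw [h]
  exact hp

theorem memLp_comp_finCons {n : ℕ} (K : L2 (n + 1)) :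
    MemLp (fun p : ℝ × (Fin n → ℝ) => K (Fin.cons p.1 p.2 : Fin (n + 1) → ℝ)) 2
      ((volume : Measure ℝ).prod volume) :=
  (Lp.memLp K).comp_measurePreserving (measurePreserving_finCons n)

theorem memLp_mul_prod {n : ℕ} (h : L2R) (G : L2 n) :
    MemLp (fun p : ℝ × (Fin n → ℝ) => h p.1 * G p.2) 2 ((volume : Measure ℝ).prod volume) := by
  have hm : AEStronglyMeasurable (fun p : ℝ × (Fin n → ℝ) => h p.1 * G p.2)
      ((volume : Measure ℝ).prod volume) := (Lp.memLp h).1.comp_fst.mul (Lp.memLp G).1.comp_snd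
  rw [memLp_two_iff_integrable_sq hm]
  simpa only [mul_pow] using (Lp.memLp h).integrable_sq.mul_prod (Lp.memLp G).integrable_sq

theorem norm_mul_prod {n : ℕ} (h : L2R) (G : L2 n) :
    ‖(memLp_mul_prod h G).toLp‖ = ‖h‖ * ‖G‖ := by
  refine (pow_left_inj₀ (norm_nonneg _) (by positivity) two_ne_zero).1 ?_
  have e : ∀ {α : Type} [MeasurableSpace α] {μ : Measure α} (f : Lp ℝ 2 μ),
      ‖f‖ ^ 2 = ∫ x, f x ^ 2 ∂μ := fun f => by
    rw [← real_inner_self_eq_norm_sq, real_inner_eq_integral_mul]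
    simp only [sq]
  rw [norm_sq_toLp_two, mul_pow, e h, e G, ← integral_prod_mul]
  simp only [mul_pow]

theorem integrable_kernel_mul_prod {n : ℕ} (K : L2 (n + 1)) (h : L2R) (G : L2 n) :
    Integrable (fun p : ℝ × (Fin n → ℝ) =>
      K (Fin.cons p.1 p.2 : Fin (n + 1) → ℝ) * (h p.1 * G p.2))
      ((volume : Measure ℝ).prod volume) :=
  MemLp.integrable_mul (memLp_comp_finCons K) (memLp_mul_prod h G)

theorem inner_contract {n : ℕ} (K : L2 (n + 1)) (h : L2R) (G : L2 n) :
    inner ℝ (memLp_contract h K).toLp G =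
      ∫ p : ℝ × (Fin n → ℝ), K (Fin.cons p.1 p.2 : Fin (n + 1) → ℝ) * (h p.1 * G p.2)
        ∂((volume : Measure ℝ).prod volume) := by
  rw [integral_prod_symm _ (integrable_kernel_mul_prod K h G), real_inner_comm, real_inner_toLp]
  refine integral_congr_ae (ae_of_all _ fun x => ?_)
  simp only
  rw [← integral_const_mul]
  refine integral_congr_ae (ae_of_all _ fun v => ?_)
  simp only
  ring

/-- By Fubini the contraction is an inner product on `ℝ × ℝⁿ`, where Cauchy–Schwarz bounds it
linearly in `‖h‖`. -/
theorem inner_contract_eq {n : ℕ} (K : L2 (n + 1)) (h : L2R) (G : L2 n) :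
    inner ℝ (memLp_contract h K).toLp G =
      inner ℝ (memLp_comp_finCons K).toLp (memLp_mul_prod h G).toLp := by
  rw [inner_contract, real_inner_toLp]
  refine integral_congr_ae ?_
  filter_upwards [(memLp_comp_finCons K).coeFn_toLp] with p hp
  rw [hp]

theorem norm_comp_finCons {n : ℕ} (K : L2 (n + 1)) : ‖(memLp_comp_finCons K).toLp‖ = ‖K‖ := by
  have := Lp.norm_compMeasurePreserving K (measurePreserving_finCons n)
  rw [← this, Lp.norm_def, Lp.norm_def]
  congr 1
  exact eLpNorm_congr_ae ((memLp_comp_finCons K).coeFn_toLp.trans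
    (Lp.coeFn_compMeasurePreserving K (measurePreserving_finCons n)).symm)

theorem abs_inner_contract_le {n : ℕ} (K : L2 (n + 1)) (h : L2R) (G : L2 n) :
    |inner ℝ (memLp_contract h K).toLp G| ≤ ‖K‖ * ‖G‖ * ‖h‖ := by
  rw [inner_contract_eq]
  refine (abs_real_inner_le_norm _ _).trans_eq ?_
  rw [norm_comp_finCons, norm_mul_prod]
  ring

/-- The functional `h ↦ ⟨(h, K)_{L²(ℝ)}, G⟩`. -/
noncomputable def contractFunctional {n : ℕ} (K : L2 (n + 1)) (G : L2 n) : L2R →L[ℝ] ℝ :=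
  LinearMap.mkContinuous
    { toFun := fun h => inner ℝ (memLp_contract h K).toLp G
      -- Linearity is read off the double integral, since representatives of sums in `Lp` are
      -- additive only almost everywhere.
      map_add' := fun h k => by
        rw [inner_contract, inner_contract, inner_contract,
          ← integral_add (integrable_kernel_mul_prod K h G) (integrable_kernel_mul_prod K k G)]
        refine integral_congr_ae ?_
        filter_upwards [Measure.quasiMeasurePreserving_fst.ae (Lp.coeFn_add h k)] with p hp
        rw [hp, Pi.add_apply]
        ring
      map_smul' := fun c h => by
        rw [inner_contract, inner_contract, RingHom.id_apply, smul_eq_mul, ← integral_const_mul]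
        refine integral_congr_ae ?_
        filter_upwards [Measure.quasiMeasurePreserving_fst.ae (Lp.coeFn_smul c h)] with p hp
        rw [hp, Pi.smul_apply, smul_eq_mul]
        ring }
    (‖K‖ * ‖G‖) (fun h => abs_inner_contract_le K h G)

theorem norm_contractFunctional_le {n : ℕ} (K : L2 (n + 1)) (G : L2 n) :
    ‖contractFunctional K G‖ ≤ ‖K‖ * ‖G‖ :=
  LinearMap.mkContinuous_norm_le _ (by positivity) _

theorem inner_tensorKernel_finCons {n : ℕ} (K : L2 (n + 1)) (η ξ : 𝓢(ℝ, ℝ)) :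
    inner ℝ K (tensorKernel (Fin.cons η fun _ : Fin n => ξ : Fin (n + 1) → 𝓢(ℝ, ℝ))) =
      ∫ p : ℝ × (Fin n → ℝ), K (Fin.cons p.1 p.2 : Fin (n + 1) → ℝ) * (η p.1 * ∏ i, ξ (p.2 i))
        ∂((volume : Measure ℝ).prod volume) := by
  rw [inner_tensorKernel, ← integral_comp_of_measurePreserving (measurePreserving_finCons n)
    (integrable_mul_tensorProd K _).aestronglyMeasurable]
  simp only [Fin.prod_univ_succ, Fin.cons_zero, Fin.cons_succ]

theorem kernel_mul_prod_ae_eq {n : ℕ} (K : L2 (n + 1)) (η ξ : 𝓢(ℝ, ℝ)) :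
    (fun p : ℝ × (Fin n → ℝ) => K (Fin.cons p.1 p.2 : Fin (n + 1) → ℝ) *
        ((η.toLp 2 : L2R) p.1 * tensorKernel (fun _ : Fin n => ξ) p.2))
      =ᵐ[(volume : Measure ℝ).prod volume] fun p =>
        K (Fin.cons p.1 p.2 : Fin (n + 1) → ℝ) * (η p.1 * ∏ i, ξ (p.2 i)) := by
  filter_upwards [Measure.quasiMeasurePreserving_fst.ae (η.coeFn_toLp 2 (volume : Measure ℝ)),
    Measure.quasiMeasurePreserving_snd.ae
      (memLp_tensorProd (fun _ : Fin n => ξ)).coeFn_toLp] with p h1 h2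
  rw [h1, tensorKernel, h2]

theorem inner_contract_toLp {n : ℕ} (K : L2 (n + 1)) (η ξ : 𝓢(ℝ, ℝ)) :
    inner ℝ (memLp_contract (η.toLp 2) K).toLp (tensorKernel fun _ : Fin n => ξ) =
      inner ℝ K (tensorKernel (Fin.cons η fun _ : Fin n => ξ : Fin (n + 1) → 𝓢(ℝ, ℝ))) := by
  rw [inner_contract, inner_tensorKernel_finCons]
  exact integral_congr_ae (kernel_mul_prod_ae_eq K η ξ)

/-! ### The gradient of an `S`-transform -/

/-- Expand the product; `s` is the set of slots occupied by `η`. -/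
theorem inner_tensorKernel_add {n : ℕ} (K : L2 n) (ξ η : 𝓢(ℝ, ℝ)) :
    inner ℝ K (tensorKernel fun _ : Fin n => ξ + η) =
      ∑ s : Finset (Fin n), inner ℝ K (tensorKernel fun i => if i ∈ s then η else ξ) := by
  simp only [inner_tensorKernel]
  rw [← integral_finsetSum _ fun s _ => integrable_mul_tensorProd K _]
  refine integral_congr_ae (ae_of_all _ fun x => ?_)
  simp only [← Finset.mul_sum]
  congr 1
  simp only [add_apply, add_comm (ξ _)]
  rw [Fintype.prod_add]
  refine Finset.sum_congr rfl fun s _ => ?_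
  rw [← Finset.prod_mul_prod_compl s (fun i => (if i ∈ s then η else ξ) (x i))]
  congr 1
  · exact Finset.prod_congr rfl fun i hi => by rw [if_pos hi]
  · exact Finset.prod_congr rfl fun i hi => by rw [if_neg (Finset.mem_compl.1 hi)]

theorem abs_inner_tensorKernel_ite_le {n : ℕ} (K : L2 n) (ξ η : 𝓢(ℝ, ℝ)) (s : Finset (Fin n)) :
    |inner ℝ K (tensorKernel fun i => if i ∈ s then η else ξ)| ≤
      ‖K‖ * (‖η.toLp 2‖ ^ s.card * ‖ξ.toLp 2‖ ^ (n - s.card)) := by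
  refine (abs_inner_tensorKernel_le K _).trans_eq ?_
  rw [← Finset.prod_mul_prod_compl s]
  congr 2
  · rw [Finset.prod_congr rfl fun i hi => by rw [if_pos hi], Finset.prod_const]
  · rw [Finset.prod_congr rfl fun i hi => by rw [if_neg (Finset.mem_compl.1 hi)],
      Finset.prod_const, Finset.card_compl, Fintype.card_fin]

/-- Symmetry of `K` lets the only `η` move to the first slot. The `n + 1` equal terms give the
factor `n + 1` of the derivative. -/
theorem inner_tensorKernel_singleton {n : ℕ} {K : L2 (n + 1)} (hK : IsSymmKernel K)
    (ξ η : 𝓢(ℝ, ℝ)) (j : Fin (n + 1)) :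
    inner ℝ K (tensorKernel fun i => if i ∈ ({j} : Finset (Fin (n + 1))) then η else ξ) =
      inner ℝ K (tensorKernel (Fin.cons η fun _ : Fin n => ξ : Fin (n + 1) → 𝓢(ℝ, ℝ))) := by
  rw [← inner_tensorKernel_comp_perm hK _ (Equiv.swap 0 j)]
  congr 2
  funext i
  simp only [Function.comp_apply, Finset.mem_singleton]
  have : Equiv.swap 0 j i = j ↔ i = 0 := by
    rw [← Equiv.eq_symm_apply, Equiv.symm_swap, Equiv.swap_apply_right]
  rw [if_congr this rfl rfl]
  refine Fin.cases ?_ (fun k => ?_) i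
  · simp
  · simp [Fin.succ_ne_zero]

/-- The subtracted terms are exactly the subsets with zero or one slot filled by `η`. Every other
subset contributes at least two factors `‖η‖ ≤ 1`, so `‖η‖²` comes out and the binomial sum is taken
with `1` in place of `‖η‖`. -/
theorem abs_inner_tensorKernel_add_sub_le {n : ℕ} {K : L2 (n + 1)} (hK : IsSymmKernel K)
    (ξ η : 𝓢(ℝ, ℝ)) (hη : ‖η.toLp 2‖ ≤ 1) :
    |inner ℝ K (tensorKernel fun _ : Fin (n + 1) => ξ + η) -
        inner ℝ K (tensorKernel fun _ : Fin (n + 1) => ξ) -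
        ((n : ℝ) + 1) *
          inner ℝ K (tensorKernel (Fin.cons η fun _ : Fin n => ξ : Fin (n + 1) → 𝓢(ℝ, ℝ)))| ≤
      ‖η.toLp 2‖ ^ 2 * (‖K‖ * (1 + ‖ξ.toLp 2‖) ^ (n + 1)) := by
  set a := ‖ξ.toLp 2‖
  set b := ‖η.toLp 2‖
  set c : Finset (Fin (n + 1)) → ℝ := fun s =>
    inner ℝ K (tensorKernel fun i => if i ∈ s then η else ξ) with hc
  have hb0 : 0 ≤ b := norm_nonneg _
  have h0 : ∑ s : Finset (Fin (n + 1)), (if s.card = 0 then c s else 0) =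
      inner ℝ K (tensorKernel fun _ : Fin (n + 1) => ξ) := by
    simp [Finset.card_eq_zero, hc]
  have h1 : ∑ s : Finset (Fin (n + 1)), (if s.card = 1 then c s else 0) = ((n : ℝ) + 1) *
      inner ℝ K (tensorKernel (Fin.cons η fun _ : Fin n => ξ : Fin (n + 1) → 𝓢(ℝ, ℝ))) := by
    rw [← Finset.sum_filter, Finset.univ_filter_card_eq, Finset.powersetCard_one,
      Finset.sum_map]
    simp only [hc, Function.Embedding.coeFn_mk]
    rw [Finset.sum_congr rfl fun j _ => inner_tensorKernel_singleton hK ξ η j]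
    simp
  rw [inner_tensorKernel_add, ← h0, ← h1, ← Finset.sum_sub_distrib, ← Finset.sum_sub_distrib,
    show (1 + a) ^ (n + 1) = ∑ s : Finset (Fin (n + 1)), 1 ^ s.card * a ^ (n + 1 - s.card) from
      (Fin.sum_pow_mul_eq_add_pow 1 a).symm, Finset.mul_sum, Finset.mul_sum]
  refine (Finset.abs_sum_le_sum_abs _ _).trans (Finset.sum_le_sum fun s _ => ?_)
  have hs := abs_inner_tensorKernel_ite_le K ξ η s
  have hr : 0 ≤ b ^ 2 * (‖K‖ * (1 ^ s.card * a ^ (n + 1 - s.card))) := by positivity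
  rcases Nat.lt_or_ge s.card 2 with h | h
  · interval_cases hcard : s.card
    · simpa [hc] using hr
    · simpa [hc] using hr
  · rw [if_neg (by omega), if_neg (by omega), sub_zero, sub_zero]
    refine hs.trans ?_
    rw [one_pow, one_mul, mul_left_comm (b ^ 2)]
    exact mul_le_mul_of_nonneg_left (mul_le_mul_of_nonneg_right (pow_le_pow_of_le_one hb0 hη h)
      (by positivity)) (norm_nonneg _)

/-- The factor produced by differentiation is absorbed by enlarging the radius by one, which is
harmless because the kernel series converges at every radius. -/
theorem natCast_add_one_mul_pow_le (n : ℕ) {a : ℝ} (ha : 0 ≤ a) :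
    ((n : ℝ) + 1) * a ^ n ≤ (a + 1) ^ (n + 1) := by
  induction n with
  | zero => simpa using ha
  | succ n ih =>
    have h1 : a ^ (n + 1) ≤ (a + 1) ^ (n + 1) := by gcongr; linarith
    push_cast
    rw [pow_succ (a + 1) (n + 1)]
    nlinarith [mul_le_mul_of_nonneg_left ih ha, pow_succ a n]

/-- The derivative of the `S`-transform of `Φ` at `ξ`. -/
noncomputable def STransformDeriv (Φ : GStar) (ξ : 𝓢(ℝ, ℝ)) : L2R →L[ℝ] ℝ :=
  ∑' n : ℕ, ((n : ℝ) + 1) •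
    contractFunctional ((Φ : ∀ n, L2 n) (n + 1)) (tensorKernel fun _ : Fin n => ξ)

theorem summable_STransformDeriv (Φ : GStar) (ξ : 𝓢(ℝ, ℝ)) :
    Summable fun n : ℕ => ((n : ℝ) + 1) •
      contractFunctional ((Φ : ∀ n, L2 n) (n + 1)) (tensorKernel fun _ : Fin n => ξ) := by
  have ha : 0 ≤ ‖ξ.toLp 2‖ := norm_nonneg _
  have h := (summable_nat_add_iff 1).2 (summable_norm_mul_pow Φ (add_nonneg ha zero_le_one))
  refine Summable.of_norm_bounded h fun n => ?_
  rw [norm_smul, Real.norm_of_nonneg (by positivity)]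
  calc _ ≤ ((n : ℝ) + 1) * (‖(Φ : ∀ n, L2 n) (n + 1)‖ * ‖ξ.toLp 2‖ ^ n) := by
        gcongr
        rw [← norm_tensorKernel_const]
        exact norm_contractFunctional_le _ _
    _ = ‖(Φ : ∀ n, L2 n) (n + 1)‖ * (((n : ℝ) + 1) * ‖ξ.toLp 2‖ ^ n) := by ring
    _ ≤ _ := by
        gcongr
        exact natCast_add_one_mul_pow_le n ha

theorem hasSum_STransformDeriv (Φ : GStar) (ξ : 𝓢(ℝ, ℝ)) (h : L2R) :
    HasSum (fun n : ℕ => ((n : ℝ) + 1) *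
      inner ℝ (memLp_contract h ((Φ : ∀ n, L2 n) (n + 1))).toLp (tensorKernel fun _ : Fin n => ξ))
      (STransformDeriv Φ ξ h) :=
  (summable_STransformDeriv Φ ξ).hasSum.mapL (ContinuousLinearMap.apply ℝ ℝ h)

/-- `dirDeriv h Φ` need not be known to lie in `GStar`: its pairing with `expVector ξ` is already a
convergent series. -/
theorem STransformDeriv_apply (Φ : GStar) (ξ : 𝓢(ℝ, ℝ)) (h : L2R) :
    STransformDeriv Φ ξ h = pairing (dirDeriv h Φ) (expVector ξ) := by
  rw [pairing_expVector, ← (hasSum_STransformDeriv Φ ξ h).tsum_eq]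
  exact tsum_congr fun n => by rw [dirDeriv, real_inner_smul_left]

theorem exists_abs_STransform_add_sub_le (Φ : GStar) (ξ : 𝓢(ℝ, ℝ)) :
    ∃ C : ℝ, ∀ η : 𝓢(ℝ, ℝ), ‖η.toLp 2‖ ≤ 1 →
      |STransform Φ (ξ + η) - STransform Φ ξ - STransformDeriv Φ ξ (η.toLp 2)| ≤
        C * ‖η.toLp 2‖ ^ 2 := by
  have hC := (summable_nat_add_iff 1).2
    (summable_norm_mul_pow Φ (add_nonneg zero_le_one (norm_nonneg (ξ.toLp 2))))
  refine ⟨∑' n : ℕ, ‖(Φ : ∀ n, L2 n) (n + 1)‖ * (1 + ‖ξ.toLp 2‖) ^ (n + 1), fun η hη => ?_⟩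
  have e := ((((hasSum_nat_add_iff' 1).2 (hasSum_STransform Φ (ξ + η))).sub
    ((hasSum_nat_add_iff' 1).2 (hasSum_STransform Φ ξ))).sub
    (hasSum_STransformDeriv Φ ξ (η.toLp 2)))
  -- The chaos of order zero does not depend on `ξ`, so it cancels and all three series are indexed
  -- by degree `n + 1`.
  have h0 : ∀ ζ ζ' : 𝓢(ℝ, ℝ), tensorKernel (fun _ : Fin 0 => ζ) = tensorKernel fun _ => ζ' :=
    fun ζ ζ' => congrArg _ (Subsingleton.elim _ _)
  simp only [Finset.sum_range_one, h0 (ξ + η) ξ, sub_sub_sub_cancel_right,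
    inner_contract_toLp] at e
  rw [mul_comm]
  have hb := hC.hasSum.mul_left (‖η.toLp 2‖ ^ 2)
  rw [← Real.norm_eq_abs, ← e.tsum_eq]
  refine tsum_of_norm_bounded hb fun n => ?_
  exact abs_inner_tensorKernel_add_sub_le (Φ.2.1 (n + 1)) ξ η hη

/-- The filter is the one induced by the `L²`-norm, not by the Schwartz topology, so a quadratic
bound in that norm suffices. -/
theorem isLittleO_comap_of_abs_le_sq {α : Type*} {N R : α → ℝ} {C : ℝ}
    (h : ∀ x, N x ≤ 1 → |R x| ≤ C * N x ^ 2) : R =o[comap N (𝓝 0)] N := by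
  have hl : Tendsto N (comap N (𝓝 0)) (𝓝 0) := tendsto_comap
  have h1 : R =O[comap N (𝓝 0)] fun x => N x ^ 2 := by
    refine Asymptotics.IsBigO.of_bound C ?_
    filter_upwards [hl.eventually_le_const one_pos] with x hx
    simpa using h x hx
  refine h1.trans_isLittleO ?_
  simpa [pow_two] using (((Asymptotics.isLittleO_one_iff ℝ).2 hl).mul_isBigO
    (Asymptotics.isBigO_refl N _))

theorem hasFunctionalGradient_STransform (Φ : GStar) (ξ : 𝓢(ℝ, ℝ)) :
    HasFunctionalGradient (STransform Φ) ξ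
      ((InnerProductSpace.toDual ℝ L2R).symm (STransformDeriv Φ ξ)) := by
  obtain ⟨C, hC⟩ := exists_abs_STransform_add_sub_le Φ ξ
  refine isLittleO_comap_of_abs_le_sq (C := C) fun η hη => ?_
  rw [InnerProductSpace.toDual_symm_apply]
  exact hC η hη

/-- By Riesz, testing the gradient on the approximate delta gives the pairing from the definition of
`D_s`; the two limits coincide. -/
theorem IsStochDeriv.hasFunctionalDerivAt {ρ : Profile} {Φ Ψ : GStar} {s : ℝ}
    (h : IsStochDeriv ρ Φ s Ψ) (ξ : 𝓢(ℝ, ℝ)) :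
    HasFunctionalDerivAt ρ (STransform Φ) ξ s (STransform Ψ ξ) := by
  refine ⟨_, hasFunctionalGradient_STransform Φ ξ, ?_⟩
  simp only [InnerProductSpace.toDual_symm_apply, STransformDeriv_apply]
  exact h _ (isTest_expVector ξ)

/-! ### `S`-transforms of the operator `𝒦_g` and of Skorohod integrals -/

theorem IsVolterraK.stieltjesIntegrable {g : ℝ → ℝ → ℝ} {Φ : ℝ → GStar} {t s : ℝ} {X : GStar}
    (h : IsVolterraK g Φ t s X) (ξ : 𝓢(ℝ, ℝ)) :
    StieltjesIntegrable (fun u => STransform (Φ u) ξ - STransform (Φ s) ξ)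
      (fun u => g u s) s t := by
  obtain ⟨-, J, hJ, -⟩ := h
  have := (hJ _ (isTest_expVector ξ)).1
  simp only [pairing_sub _ _ (isTest_expVector ξ)] at this
  exact this

theorem IsVolterraK.STransform_eq {g : ℝ → ℝ → ℝ} {Φ : ℝ → GStar} {t s : ℝ} {X : GStar}
    (h : IsVolterraK g Φ t s X) (ξ : 𝓢(ℝ, ℝ)) :
    STransform X ξ = volterraK g (fun u => STransform (Φ u) ξ) t s := by
  obtain ⟨-, J, hJ, rfl⟩ := h
  have := (hJ _ (isTest_expVector ξ)).2
  simp only [pairing_sub _ _ (isTest_expVector ξ)] at this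
  rw [STransform, pairing_add _ _ (isTest_expVector ξ), pairing_smul, this, volterraK, mul_comm]
  rfl

/-! ### Skorohod integrals: symmetrization, Fubini and exchange of sum and integral. -/

theorem integrable_kernel_mul_tensor {n : ℕ} (K : L2 (n + 1)) (η ξ : 𝓢(ℝ, ℝ)) :
    Integrable (fun p : ℝ × (Fin n → ℝ) =>
      K (Fin.cons p.1 p.2 : Fin (n + 1) → ℝ) * (η p.1 * ∏ i, ξ (p.2 i)))
      ((volume : Measure ℝ).prod volume) :=
  (integrable_kernel_mul_prod K (η.toLp 2) (tensorKernel fun _ => ξ)).congr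
    (kernel_mul_prod_ae_eq K η ξ)

/-- `ξ^{⊗n}` is permutation invariant, so all `n!` terms of the average have the same integral. -/
theorem inner_symmetrization_tensorKernel {n : ℕ} {K Y : L2 n}
    (hY : (Y : (Fin n → ℝ) → ℝ) =ᵐ[volume]
      fun y => ((n.factorial : ℝ))⁻¹ * ∑ σ : Equiv.Perm (Fin n), K (y ∘ σ)) (ξ : 𝓢(ℝ, ℝ)) :
    inner ℝ Y (tensorKernel fun _ : Fin n => ξ) = inner ℝ K (tensorKernel fun _ : Fin n => ξ) := by
  have hn : (n.factorial : ℝ) ≠ 0 := by positivity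
  set T : (Fin n → ℝ) → ℝ := fun x => ∏ i, ξ (x i) with hT
  have hTσ : ∀ (σ : Equiv.Perm (Fin n)) x, T (x ∘ σ) = T x := fun σ x =>
    Equiv.prod_comp σ (fun i => ξ (x i))
  have hi : Integrable (fun x => K x * T x) := integrable_mul_tensorProd K fun _ => ξ
  have hiσ : ∀ σ : Equiv.Perm (Fin n), Integrable fun x => K (x ∘ σ) * T x := fun σ => by
    have h := (permMeasurePreserving σ).integrable_comp_of_integrable hi
    refine h.congr (ae_of_all _ fun x => ?_)
    simp only [Function.comp_apply, hTσ σ]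
  rw [inner_tensorKernel, inner_tensorKernel]
  have h1 : ∫ x, Y x * T x =
      ∫ x, ((n.factorial : ℝ))⁻¹ * ∑ σ : Equiv.Perm (Fin n), K (x ∘ σ) * T x := by
    refine integral_congr_ae ?_
    filter_upwards [hY] with x hx
    rw [hx, mul_assoc, Finset.sum_mul]
  rw [h1, integral_const_mul, integral_finsetSum _ fun σ _ => hiσ σ]
  have h2 : ∀ σ : Equiv.Perm (Fin n), ∫ x, K (x ∘ σ) * T x = ∫ x, K x * T x := fun σ => by
    rw [← integral_comp_perm σ hi.aestronglyMeasurable]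
    simp only [hTσ σ]
  simp only [h2, Finset.sum_const, Finset.card_univ, Fintype.card_perm, Fintype.card_fin,
    nsmul_eq_mul]
  rw [inv_mul_cancel_left₀ hn]

theorem integrableOn_and_integral_of_kernel {n : ℕ} {t : ℝ} {f : ℝ → L2 n} {κ : L2 (n + 1)}
    (hκ : ∀ᵐ s : ℝ, (fun x : Fin n → ℝ => κ (Fin.cons s x : Fin (n + 1) → ℝ)) =ᵐ[volume]
      (Ioc (0 : ℝ) t).indicator (fun s => (f s : (Fin n → ℝ) → ℝ)) s) (ξ : 𝓢(ℝ, ℝ)) :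
    IntegrableOn (fun s => inner ℝ (f s) (tensorKernel fun _ : Fin n => ξ) * ξ s) (Ioc 0 t) ∧
      inner ℝ κ (tensorKernel fun _ : Fin (n + 1) => ξ) =
        ∫ s in Ioc 0 t, inner ℝ (f s) (tensorKernel fun _ : Fin n => ξ) * ξ s := by
  have hi := integrable_kernel_mul_tensor κ ξ ξ
  have hae : (fun s => ∫ x : Fin n → ℝ,
      κ (Fin.cons s x : Fin (n + 1) → ℝ) * (ξ s * ∏ i, ξ (x i))) =ᵐ[volume]
      (Ioc (0 : ℝ) t).indicator
        fun s => inner ℝ (f s) (tensorKernel fun _ : Fin n => ξ) * ξ s := by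
    filter_upwards [hκ] with s hs
    by_cases hst : s ∈ Ioc (0 : ℝ) t
    · rw [indicator_of_mem hst] at hs
      rw [indicator_of_mem hst, inner_tensorKernel, ← integral_mul_const]
      refine integral_congr_ae ?_
      filter_upwards [hs] with x hx
      rw [hx]
      ring
    · rw [indicator_of_notMem hst] at hs
      rw [indicator_of_notMem hst]
      refine integral_eq_zero_of_ae ?_
      filter_upwards [hs] with x hx
      rw [hx, Pi.zero_apply, zero_mul]
  constructor
  · rw [← integrable_indicator_iff measurableSet_Ioc]
    exact hi.integral_prod_left.congr hae
  · have hcons : (fun _ : Fin (n + 1) => ξ) = Fin.cons ξ fun _ : Fin n => ξ := by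
      funext i
      refine Fin.cases ?_ (fun k => ?_) i <;> simp
    rw [hcons, inner_tensorKernel_finCons, integral_prod _ hi, integral_congr_ae hae,
      integral_indicator measurableSet_Ioc]

theorem tsum_lintegral_enorm_lt_top {t : ℝ} {f : ℝ → GStar} (hf : SquareIntegrableProcess t f)
    (ξ : 𝓢(ℝ, ℝ))
    (hm : ∀ n, AEStronglyMeasurable (fun s =>
      inner ℝ ((f s : ∀ n, L2 n) n) (tensorKernel fun _ : Fin n => ξ) * ξ s)
      (volume.restrict (Ioc 0 t))) :
    ∑' n : ℕ, ∫⁻ s in Ioc 0 t,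
      ‖inner ℝ ((f s : ∀ n, L2 n) n) (tensorKernel fun _ : Fin n => ξ) * ξ s‖ₑ < ∞ := by
  obtain ⟨lam, -, hlam⟩ := hf
  set a := ‖ξ.toLp 2‖
  have ha : 0 ≤ a := norm_nonneg _
  set c : ℝ≥0∞ := ∑' n : ℕ, ENNReal.ofReal ((Real.exp (2 * lam) * a ^ 2) ^ n / n.factorial)
  have hc : c < ∞ :=
    (Real.summable_pow_div_factorial (Real.exp (2 * lam) * a ^ 2)).tsum_ofReal_lt_top
  have hξ : Measurable fun s => ENNReal.ofReal (ξ s ^ 2) :=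
    ((ξ.continuous.pow 2).measurable).ennreal_ofReal
  have hξi : ∫⁻ s in Ioc 0 t, ENNReal.ofReal (ξ s ^ 2) < ∞ :=
    ((ξ.memLp 2 volume).integrable_sq.integrableOn (s := Ioc 0 t)).lintegral_lt_top
  rw [← lintegral_tsum fun n => (hm n).enorm]
  calc _ ≤ ∫⁻ s in Ioc 0 t, (chaosNormSq (-lam) (f s) + c * ENNReal.ofReal (ξ s ^ 2)) := by
        refine lintegral_mono fun s => ?_
        simp only [chaosNormSq, c]
        rw [← ENNReal.tsum_mul_right, ← ENNReal.tsum_add]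
        refine ENNReal.tsum_le_tsum fun n => ?_
        rw [← ENNReal.ofReal_mul (by positivity), ← ENNReal.ofReal_add (by positivity)
          (by positivity), ← ofReal_norm]
        refine ENNReal.ofReal_le_ofReal ?_
        rw [norm_mul, Real.norm_eq_abs]
        have h1 := abs_inner_tensorKernel_le ((f s : ∀ n, L2 n) n) (fun _ : Fin n => ξ)
        rw [Finset.prod_const, Finset.card_univ, Fintype.card_fin] at h1
        have h2 := norm_mul_pow_le n lam a _ ‖ξ s‖ (norm_nonneg ((f s : ∀ n, L2 n) n)) ha
          (norm_nonneg _)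
        rw [Real.norm_eq_abs (ξ s), sq_abs] at h2
        exact (mul_le_mul_of_nonneg_right h1 (abs_nonneg _)).trans h2
    _ < ∞ := by
        -- Only the `ξ`-term is known to be measurable in `s`; the chaos norm of the process need
        -- not be, hence additivity through the right summand.
        rw [lintegral_add_right _ (hξ.const_mul c), lintegral_const_mul c hξ]
        exact ENNReal.add_lt_top.2 ⟨hlam, ENNReal.mul_lt_top hc hξi⟩

theorem IsSkorohodIntegral.STransform_eq {t : ℝ} {f : ℝ → GStar} {Y : GStar}
    (h : IsSkorohodIntegral t f Y) (hf : SquareIntegrableProcess t f) (ξ : 𝓢(ℝ, ℝ)) :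
    IntegrableOn (fun s => STransform (f s) ξ * ξ s) (Ioc 0 t) ∧
      STransform Y ξ = ∫ s in Ioc 0 t, STransform (f s) ξ * ξ s := by
  obtain ⟨κ, hκ, hY0, hY⟩ := h
  let F : ℕ → ℝ → ℝ := fun n s =>
    inner ℝ ((f s : ∀ n, L2 n) n) (tensorKernel fun _ : Fin n => ξ) * ξ s
  have hF := fun n => integrableOn_and_integral_of_kernel (hκ n) ξ
  have hm : ∀ n, AEStronglyMeasurable (F n) (volume.restrict (Ioc 0 t)) :=
    fun n => (hF n).1.aestronglyMeasurable
  have htop := tsum_lintegral_enorm_lt_top hf ξ hm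
  have hsum : ∀ s, HasSum (fun n => F n s) (STransform (f s) ξ * ξ s) := fun s =>
    (hasSum_STransform (f s) ξ).mul_right _
  have hYsum : HasSum (fun n => ∫ s in Ioc 0 t, F n s) (STransform Y ξ) := by
    -- Since the kernel of order zero vanishes, the chaos of order `n + 1` of `Y` is matched with
    -- that of order `n` of the process.
    have h1 := (hasSum_nat_add_iff' 1).2 (hasSum_STransform Y ξ)
    rw [Finset.sum_range_one, hY0, inner_zero_left, sub_zero] at h1
    refine h1.congr_fun fun n => ?_
    rw [← (hF n).2, inner_symmetrization_tensorKernel (hY n)]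
  constructor
  · refine ⟨?_, ?_⟩
    · refine aestronglyMeasurable_of_tendsto_ae atTop
        (fun N => Finset.aestronglyMeasurable_fun_sum (Finset.range N) fun n _ => hm n)
        (ae_of_all _ fun s => (hsum s).tendsto_sum_nat)
    · rw [HasFiniteIntegral]
      refine lt_of_le_of_lt (lintegral_mono fun s => ?_)
        ((lintegral_tsum fun n => (hm n).enorm).trans_lt htop)
      rw [← (hsum s).tsum_eq]
      exact enorm_tsum_le_tsum_enorm
  · rw [← hYsum.tsum_eq, ← integral_tsum hm htop.ne]
    exact integral_congr_ae (ae_of_all _ fun s => (hsum s).tsum_eq)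

/-! ### Functional derivative of `𝒦_g` and assembly of both formulas. -/

theorem STransform_add (Φ Ψ : GStar) (ξ : 𝓢(ℝ, ℝ)) :
    STransform (Φ + Ψ) ξ = STransform Φ ξ + STransform Ψ ξ :=
  pairing_add Φ Ψ (isTest_expVector ξ)

theorem IsVolterraK.hasFunctionalDerivAt {ρ : Profile} {g : ℝ → ℝ → ℝ} {Φ : ℝ → GStar}
    {t s : ℝ} {X Ψ : GStar} (hX : IsVolterraK g Φ t s X) (hΨ : IsStochDeriv ρ X s Ψ)
    (ξ : 𝓢(ℝ, ℝ)) :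
    HasFunctionalDerivAt ρ (fun η => volterraK g (fun u => STransform (Φ u) η) t s) ξ s
      (STransform Ψ ξ) := by
  have h : (fun η => volterraK g (fun u => STransform (Φ u) η) t s) = STransform X :=
    funext fun η => (hX.STransform_eq η).symm
  rw [h]
  exact hΨ.hasFunctionalDerivAt ξ

theorem mainTheorem9 (ρ : Profile) (g : ℝ → ℝ → ℝ) (t : ℝ) (ht : 0 ≤ t) (Φ : ℝ → GStar) :
    (∀ Y : GStar, HasVolterraIntegral ρ g Φ t Y → ∀ ξ : 𝓢(ℝ, ℝ), ∃ ψ : ℝ → ℝ,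
      (∀ᵐ s ∂(volume.restrict (Ioc 0 t)), ∀ η : 𝓢(ℝ, ℝ),
        StieltjesIntegrable (fun u => STransform (Φ u) η - STransform (Φ s) η)
          (fun u => g u s) s t) ∧
      (∀ᵐ s ∂(volume.restrict (Ioc 0 t)),
        HasFunctionalDerivAt ρ (fun η => volterraK g (fun u => STransform (Φ u) η) t s) ξ s (ψ s)) ∧
      IntegrableOn (fun s => volterraK g (fun u => STransform (Φ u) ξ) t s * ξ s) (Ioc 0 t) ∧
      IntegrableOn ψ (Ioc 0 t) ∧
      STransform Y ξ =
        (∫ s in Ioc 0 t, volterraK g (fun u => STransform (Φ u) ξ) t s * ξ s) +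
          ∫ s in Ioc 0 t, ψ s) ∧
    (∀ (Sig : ℝ → GStar) (Y : GStar), HasWickVolterraIntegral ρ g Φ Sig t Y →
      ∀ ξ : 𝓢(ℝ, ℝ), ∃ ψ : ℝ → ℝ,
      (∀ᵐ s ∂(volume.restrict (Ioc 0 t)), ∀ η : 𝓢(ℝ, ℝ),
        StieltjesIntegrable (fun u => STransform (Φ u) η - STransform (Φ s) η)
          (fun u => g u s) s t) ∧
      (∀ᵐ s ∂(volume.restrict (Ioc 0 t)),
        HasFunctionalDerivAt ρ (fun η => volterraK g (fun u => STransform (Φ u) η) t s) ξ s (ψ s)) ∧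
      IntegrableOn
        (fun s => volterraK g (fun u => STransform (Φ u) ξ) t s * STransform (Sig s) ξ * ξ s)
        (Ioc 0 t) ∧
      IntegrableOn (fun s => ψ s * STransform (Sig s) ξ) (Ioc 0 t) ∧
      STransform Y ξ =
        (∫ s in Ioc 0 t,
          volterraK g (fun u => STransform (Φ u) ξ) t s * STransform (Sig s) ξ * ξ s) +
          ∫ s in Ioc 0 t, ψ s * STransform (Sig s) ξ) := by
  refine ⟨?_, ?_⟩
  · rintro Y ⟨K, D, A, B, hK, hsq, hA, hD, hB, rfl⟩ ξ
    obtain ⟨hi, he⟩ := hA.STransform_eq hsq ξ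
    obtain ⟨hi', he'⟩ := hB _ (isTest_expVector ξ)
    have hae : (fun s => STransform (K s) ξ * ξ s) =ᵐ[volume.restrict (Ioc 0 t)]
        fun s => volterraK g (fun u => STransform (Φ u) ξ) t s * ξ s := by
      filter_upwards [hK] with s hs
      rw [hs.STransform_eq]
    -- The functional derivative is the `S`-transform of the stochastic derivative; its
    -- integrability is the Pettis condition tested on `expVector ξ`.
    refine ⟨fun s => STransform (D s) ξ, ?_, ?_, hi.congr hae, hi', ?_⟩
    · filter_upwards [hK] with s hs using hs.stieltjesIntegrable
    · filter_upwards [hK, hD] with s hs hs' using hs.hasFunctionalDerivAt hs' ξ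
    · rw [STransform_add, he, integral_congr_ae hae]
      exact congrArg _ he'
  · rintro Sig Y ⟨K, D, KW, DW, A, B, hK, hKW, hsq, hA, hD, hDW, hB, rfl⟩ ξ
    obtain ⟨hi, he⟩ := hA.STransform_eq hsq ξ
    obtain ⟨hi', he'⟩ := hB _ (isTest_expVector ξ)
    have hae : (fun s => STransform (KW s) ξ * ξ s) =ᵐ[volume.restrict (Ioc 0 t)] fun s =>
        volterraK g (fun u => STransform (Φ u) ξ) t s * STransform (Sig s) ξ * ξ s := by
      filter_upwards [hK, hKW] with s hs hs'
      rw [hs' ξ, hs.STransform_eq]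
    -- The derivative acts on `𝒦_g(Φ)` alone; `Σ` enters afterwards as a scalar factor, through
    -- multiplicativity of `S` on Wick products.
    have hae' : (fun s => pairing (DW s) (expVector ξ)) =ᵐ[volume.restrict (Ioc 0 t)]
        fun s => STransform (D s) ξ * STransform (Sig s) ξ := by
      filter_upwards [hDW] with s hs using hs ξ
    refine ⟨fun s => STransform (D s) ξ, ?_, ?_, hi.congr hae, hi'.congr hae', ?_⟩
    · filter_upwards [hK] with s hs using hs.stieltjesIntegrable
    · filter_upwards [hK, hD] with s hs hs' using hs.hasFunctionalDerivAt hs' ξ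
    · rw [STransform_add, he, integral_congr_ae hae, ← integral_congr_ae hae']
      exact congrArg _ he'
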